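/- Duality of stability regions under average power constraints (two users). Let $\vec h(t)=(h_1(t),h_2(t))\in[0,\infty)^2$, $t=0,1,2,\dots$, be a stationary ergodic fading process (for instance Rayleigh fading), let $N>0$ be a noise power, and let $\mathcal R_1,\mathcal R_2\subset[0,\infty)$ be finite sets of codebook rates, each containing $0$. Write $F(h,s)=\log_2(1+h^2s)$. In each slot $t$ a centralized scheduler, knowing the law of the channel process and the channel states up to slot $t$, and possibly using randomization independent of the channel, chooses codeword rates $(r_1,r_2)\in\mathcal R_1\times\mathcal R_2$ and codeword powers $P_1(t),P_2(t)\ge 0$ with which $(r_1,r_2)$ can be decoded, by successive decoding with interference cancellation, in the current state $(h_1,h_2)$: (MAC) for $(i,j)=(1,2)$ or $(i,j)=(2,1)$ (user $i$ decoded first), $r_i\le F\big(h_i,\tfrac{P_i}{N+h_j^2P_j}\big)$ and $r_j\le F\big(h_j,\tfrac{P_j}{N}\big)$; (BC) with $(s,w)=(1,2)$ if $h_1>h_2$ and $(s,w)=(2,1)$ if $h_1\le h_2$ (both receivers decode the codeword of the weaker user $w$ first), $r_w\le F\big(h_w,\tfrac{P_w}{N+h_w^2P_s}\big)$, $r_w\le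 F\big(h_s,\tfrac{P_w}{N+h_s^2P_s}\big)$ and $r_s\le F\big(h_s,\tfrac{P_s}{N}\big)$. A broadcast (BC) network with average transmit-power constraint $\tilde P\ge0$ requires $E[P_1(t)+P_2(t)]\le\tilde P$ for all $t$. A multiple access (MAC) network with average power constraints $\tilde P_1,\tilde P_2\ge 0$ requires $E[P_i(t)]\le\tilde P_i$ for $i=1,2$ and all $t$. The stability region of a network (in its network-capacity form) is the closure of the set of all vectors $(\bar R_1,\bar R_2)$ of long-run average departure rates, $\bar R_i=\lim_{T\to\infty}\frac1T\sum_{t<T}E[r_i(t)]$, that such schedulers achieve with infinitely backlogged nodes. A MAC network is dual to a BC network if it has the same channel statistics, the same noise power and the same rate sets, and $\tilde P_1+\tilde P_2=\tilde P$. Theorem. The stability region of a broadcast network with an average transmit-power constraint equals the union of the stability regions of all its dual MAC networks. -/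

import Mathlib

open MeasureTheory Filter Topology
open scoped NNReal ENNReal

noncomputable section

namespace Fading

/-- The pair of channel amplitude gains `(h₁, h₂)` in one slot; user `1` is `0 : Fin 2`, user `2` is
`1 : Fin 2`. -/
abbrev State := Fin 2 → ℝ≥0

/-- The sequence of channel states over all slots. -/
abbrev Path := ℕ → State

/-- The time shift on channel paths. -/
def shift (x : Path) : Path := fun t => x (t + 1)

/-- The rate `log₂ (1 + g² s)` of a Gaussian link of gain `g` with power-to-noise ratio `s`. -/
def gaussianRate (g s : ℝ) : ℝ := Real.logb 2 (1 + g ^ 2 * s)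

/-- The data which a broadcast network shares with its duals: the law of the stationary ergodic
fading process, the noise power (the same at every receiver), and for each user the finite set of
codebook rates (rate `0` means that the user is silent). -/
structure FadingModel where
  channel : Measure Path
  isProbabilityMeasure : IsProbabilityMeasure channel
  ergodic : Ergodic shift channel
  noise : ℝ≥0
  noise_pos : 0 < noise
  rates : Fin 2 → Finset ℝ≥0
  zero_mem_rates : ∀ i, 0 ∈ rates i

/-- Multiple access channel, user `i` decoded first: the codeword of `i` is decoded treating the
codeword of `j` as noise, it is cancelled, and the codeword of `j` is decoded. -/
def MACDecodes (N : ℝ≥0) (h : State) (r p : Fin 2 → ℝ≥0) (i j : Fin 2) : Prop :=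
  (r i : ℝ) ≤ gaussianRate (h i) (p i / (N + (h j : ℝ) ^ 2 * p j)) ∧
  (r j : ℝ) ≤ gaussianRate (h j) (p j / N)

/-- The rate pair `r` is supported by the multiple access channel in state `h`, with user powers
`p`: one of the two orders of successive decoding works. -/
def MACSupports (N : ℝ≥0) (h : State) (r p : Fin 2 → ℝ≥0) : Prop :=
  MACDecodes N h r p 0 1 ∨ MACDecodes N h r p 1 0

/-- Broadcast channel with stronger receiver `s` and weaker receiver `w`: both receivers decode the
codeword of `w` treating the codeword of `s` as noise; then receiver `s` cancels it and decodes
its own codeword. -/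
def BCDecodes (N : ℝ≥0) (h : State) (r p : Fin 2 → ℝ≥0) (s w : Fin 2) : Prop :=
  (r w : ℝ) ≤ gaussianRate (h w) (p w / (N + (h w : ℝ) ^ 2 * p s)) ∧
  (r w : ℝ) ≤ gaussianRate (h s) (p w / (N + (h s : ℝ) ^ 2 * p s)) ∧
  (r s : ℝ) ≤ gaussianRate (h s) (p s / N)

/-- The rate pair `r` is supported by the broadcast channel in state `h`, when the codeword of user
`i` is sent with power `p i`; the channel state imposes the decoding order. -/
def BCSupports (N : ℝ≥0) (h : State) (r p : Fin 2 → ℝ≥0) : Prop :=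
  (h 1 < h 0 ∧ BCDecodes N h r p 0 1) ∨ (h 0 ≤ h 1 ∧ BCDecodes N h r p 1 0)

/-- A centralized scheduling policy for infinitely backlogged nodes: in slot `t` it picks the
codeword rates and powers of both users from the channel states of the slots `0, …, t` and from a
uniformly distributed seed, which is independent of the channel and is available at all times. -/
structure Policy where
  rate : (t : ℕ) → (Fin (t + 1) → State) → unitInterval → Fin 2 → ℝ≥0
  power : (t : ℕ) → (Fin (t + 1) → State) → unitInterval → Fin 2 → ℝ≥0
  measurable_rate : ∀ t, Measurable (Function.uncurry (rate t))
  measurable_power : ∀ t, Measurable (Function.uncurry (power t))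

/-- The rates in slot `t` on a channel path, for a given seed. -/
def Policy.rateAt (π : Policy) (t : ℕ) (ω : Path × unitInterval) : Fin 2 → ℝ≥0 :=
  π.rate t (fun k => ω.1 k) ω.2

/-- The powers in slot `t` on a channel path, for a given seed. -/
def Policy.powerAt (π : Policy) (t : ℕ) (ω : Path × unitInterval) : Fin 2 → ℝ≥0 :=
  π.power t (fun k => ω.1 k) ω.2

/-- The joint law of the channel path and the seed. -/
def FadingModel.law (M : FadingModel) : Measure (Path × unitInterval) :=
  M.channel.prod volume

/-- The policy only uses codebook rates. -/
def FadingModel.UsesRates (M : FadingModel) (π : Policy) : Prop :=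
  ∀ t ω i, π.rateAt t ω i ∈ M.rates i

/-- `x` is the vector of long-run average departure rates of the policy. -/
def FadingModel.IsAverageRate (M : FadingModel) (π : Policy) (x : Fin 2 → ℝ) : Prop :=
  ∀ i, Tendsto
    (fun T : ℕ => (∑ t ∈ Finset.range T, ∫ ω, (π.rateAt t ω i : ℝ) ∂M.law) / (T : ℝ))
    atTop (𝓝 (x i))

/-- A two-user broadcast network under an average transmit-power constraint. -/
structure BCNetwork extends FadingModel where
  power : ℝ≥0

/-- A two-user multiple access network under an average power constraint for each user. -/
structure MACNetwork extends FadingModel where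
  power : Fin 2 → ℝ≥0

/-- Policies of a broadcast network: every transmitted codeword can be decoded, and the transmit
power, which is the sum of the powers of the two codewords, obeys `E[P(t)] ≤ power`. -/
def BCNetwork.Admissible (B : BCNetwork) (π : Policy) : Prop :=
  B.UsesRates π ∧
  (∀ t ω, BCSupports B.noise (ω.1 t) (π.rateAt t ω) (π.powerAt t ω)) ∧
  ∀ t, ∫⁻ ω, ((π.powerAt t ω 0 + π.powerAt t ω 1 : ℝ≥0) : ℝ≥0∞) ∂B.law ≤ B.power

/-- Policies of a multiple access network: every transmitted codeword can be decoded, and the power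
of user `i` obeys `E[Pᵢ(t)] ≤ power i`. -/
def MACNetwork.Admissible (M : MACNetwork) (π : Policy) : Prop :=
  M.UsesRates π ∧
  (∀ t ω, MACSupports M.noise (ω.1 t) (π.rateAt t ω) (π.powerAt t ω)) ∧
  ∀ i t, ∫⁻ ω, (π.powerAt t ω i : ℝ≥0∞) ∂M.law ≤ M.power i

/-- The stability region: the closure of the set of average departure rates that can be achieved
with infinitely backlogged nodes. -/
def BCNetwork.stabilityRegion (B : BCNetwork) : Set (Fin 2 → ℝ) :=
  closure {x | ∃ π, B.Admissible π ∧ B.IsAverageRate π x}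

/-- The stability region of a multiple access network, defined in the same way. -/
def MACNetwork.stabilityRegion (M : MACNetwork) : Set (Fin 2 → ℝ) :=
  closure {x | ∃ π, M.Admissible π ∧ M.IsAverageRate π x}

/-- `M` is dual to `B`: same channel statistics, noise power and rate sets, and the average power
of `B` is the sum of the average powers of the users of `M`. -/
def MACNetwork.IsDual (M : MACNetwork) (B : BCNetwork) : Prop :=
  M.toFadingModel = B.toFadingModel ∧ M.power 0 + M.power 1 = B.power

end Fading

end

noncomputable section

namespace Fading

/-! Fix a state with stronger user `s` and weaker user `w`. Let `γ = 2 ^ r - 1` be the required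
signal-to-noise ratios and `a = γ N / h²` the interference-free powers. Broadcasting needs at least
`a_s` and `a_w + γ_w a_s`; multiple access with `s` decoded first needs `a_s (1 + γ_w)` and `a_w`.
Both totals are `a_s + a_w + γ_w a_s`, and the other multiple access order costs no less because
`h_w ≤ h_s`. Hence the same rates cost the same total power in every slot
(`BCSupports.dualMACPower_add_le`, `MACSupports.dualBCPower_add_le`).

From multiple access to broadcast this suffices. Conversely, the split of the power between the
users may drift with time, whereas a dual network fixes it. Drawing a slot `s < T` at random and
replaying forever what the policy does in slot `s`, on the shifted past, realizes the `T`-slot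
average rates under a fixed split (`Feasible.exists_average`); this uses stationarity. A point of
the broadcast region is thus a limit of rates achieved with fixed splits of the total power. The
splits form a compact set, and a limit split serves the limit rates (`mem_closure_achieves`). -/

/-! ### Least powers and duality in a single channel state. -/

/-- The signal-to-noise ratio `2 ^ r - 1` needed to decode a codeword of rate `r`. -/
def snr (r : ℝ≥0) : ℝ≥0 := 2 ^ (r : ℝ) - 1

theorem coe_snr (r : ℝ≥0) : (snr r : ℝ) = 2 ^ (r : ℝ) - 1 := by
  have h : (1 : ℝ≥0) ≤ 2 ^ (r : ℝ) := NNReal.one_le_rpow (by norm_num) r.2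
  rw [snr, NNReal.coe_sub h]
  simp

theorem snr_zero : snr 0 = 0 := by simp [snr]

theorem measurable_snr : Measurable snr := by
  unfold snr
  fun_prop

theorem le_gaussianRate_iff {r : ℝ≥0} {g s : ℝ} (hs : 0 ≤ s) :
    (r : ℝ) ≤ gaussianRate g s ↔ (snr r : ℝ) ≤ g ^ 2 * s := by
  have : 0 ≤ g ^ 2 * s := by positivity
  rw [gaussianRate, Real.le_logb_iff_rpow_le (by norm_num) (by positivity), coe_snr]
  constructor <;> intro h <;> linarith

theorem le_gaussianRate_div_iff {r p d : ℝ≥0} {g : ℝ} (hd : 0 < d) :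
    (r : ℝ) ≤ gaussianRate g (p / d) ↔ (snr r : ℝ) * d ≤ g ^ 2 * p := by
  rw [le_gaussianRate_iff (by positivity), ← mul_div_assoc, le_div_iff₀ (by exact_mod_cast hd)]

theorem macDecodes_iff {N : ℝ≥0} (hN : 0 < N) {h : State} {r p : Fin 2 → ℝ≥0} {i j : Fin 2} :
    MACDecodes N h r p i j ↔
      snr (r i) * (N + h j ^ 2 * p j) ≤ h i ^ 2 * p i ∧ snr (r j) * N ≤ h j ^ 2 * p j := by
  have hd : 0 < N + h j ^ 2 * p j := by positivity
  have h1 := le_gaussianRate_div_iff (r := r i) (p := p i) (g := h i) hd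
  have h2 := le_gaussianRate_div_iff (r := r j) (p := p j) (g := h j) hN
  rw [MACDecodes]
  push_cast at h1
  rw [h1, h2]
  norm_cast

theorem bcDecodes_iff {N : ℝ≥0} (hN : 0 < N) {h : State} {r p : Fin 2 → ℝ≥0} {s w : Fin 2} :
    BCDecodes N h r p s w ↔
      snr (r w) * (N + h w ^ 2 * p s) ≤ h w ^ 2 * p w ∧
      snr (r w) * (N + h s ^ 2 * p s) ≤ h s ^ 2 * p w ∧ snr (r s) * N ≤ h s ^ 2 * p s := by
  have hd : 0 < N + h w ^ 2 * p s := by positivity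
  have hd' : 0 < N + h s ^ 2 * p s := by positivity
  have h1 := le_gaussianRate_div_iff (r := r w) (p := p w) (g := h w) hd
  have h2 := le_gaussianRate_div_iff (r := r w) (p := p w) (g := h s) hd'
  have h3 := le_gaussianRate_div_iff (r := r s) (p := p s) (g := h s) hN
  rw [BCDecodes]
  push_cast at h1 h2
  rw [h1, h2, h3]
  norm_cast

/-- The least power at which a codeword of rate `r` is decoded in the absence of interference. -/
def soloPower (N g r : ℝ≥0) : ℝ≥0 := snr r * N / g ^ 2

/-- The hypothesis matters only for `g = 0`: division by zero makes `soloPower` zero, and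
decodability forces `snr r * N = 0`. -/
theorem sq_mul_soloPower {N g r x : ℝ≥0} (h : snr r * N ≤ g ^ 2 * x) :
    g ^ 2 * soloPower N g r = snr r * N := by
  rcases eq_or_ne g 0 with rfl | hg
  · simp only [ne_eq, OfNat.ofNat_ne_zero, not_false_eq_true, zero_pow, zero_mul] at h ⊢
    exact (le_antisymm h zero_le).symm
  · rw [soloPower, mul_div_cancel₀ _ (pow_ne_zero 2 hg)]

theorem soloPower_le {N g r x : ℝ≥0} (h : snr r * N ≤ g ^ 2 * x) : soloPower N g r ≤ x := by
  rcases eq_or_ne g 0 with rfl | hg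
  · simp [soloPower]
  · have : 0 < g ^ 2 := by positivity
    rwa [soloPower, div_le_iff₀' this]

/-- The powers of the multiple access channel in which user `s` is decoded first. -/
def macPower (N : ℝ≥0) (s w : Fin 2) (h : State) (r : Fin 2 → ℝ≥0) :
    Fin 2 → ℝ≥0 := fun k =>
  if k = s then soloPower N (h s) (r s) * (1 + snr (r w)) else soloPower N (h w) (r w)

/-- The powers of the broadcast channel with stronger receiver `s`. -/
def bcPower (N : ℝ≥0) (s w : Fin 2) (h : State) (r : Fin 2 → ℝ≥0) :
    Fin 2 → ℝ≥0 := fun k =>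
  if k = s then soloPower N (h s) (r s)
  else soloPower N (h w) (r w) + snr (r w) * soloPower N (h s) (r s)

theorem macDecodes_macPower {N : ℝ≥0} (hN : 0 < N) {h : State} {r p : Fin 2 → ℝ≥0}
    {s w : Fin 2} (hsw : w ≠ s) (H : BCDecodes N h r p s w) :
    MACDecodes N h r (macPower N s w h r) s w := by
  rw [bcDecodes_iff hN] at H
  obtain ⟨h1, -, h3⟩ := H
  have hw : snr (r w) * N ≤ h w ^ 2 * p w := le_trans (by gcongr; exact le_self_add) h1
  rw [macDecodes_iff hN]
  simp only [macPower, if_true, if_neg hsw]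
  refine ⟨?_, (sq_mul_soloPower hw).ge⟩
  rw [sq_mul_soloPower hw, ← mul_assoc, sq_mul_soloPower h3]
  apply le_of_eq
  ring

theorem macPower_add_le {N : ℝ≥0} (hN : 0 < N) {h : State} {r p : Fin 2 → ℝ≥0}
    {s w : Fin 2} (hsw : w ≠ s) (H : BCDecodes N h r p s w) :
    macPower N s w h r s + macPower N s w h r w ≤ p s + p w := by
  rw [bcDecodes_iff hN] at H
  obtain ⟨h1, -, h3⟩ := H
  simp only [macPower, if_true, if_neg hsw]
  -- The weak codeword must overcome both the noise and the interference of the strong one, which is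
  -- received through the same gain `h w`.
  have h4 : soloPower N (h w) (r w) + snr (r w) * p s ≤ p w := by
    rcases eq_or_ne (h w) 0 with h0 | h0
    · have : snr (r w) = 0 := by
        simpa [h0, hN.ne'] using h1
      simp [soloPower, this]
    · have hp : 0 < h w ^ 2 := by positivity
      refine le_of_mul_le_mul_left ?_ hp
      have hw : snr (r w) * N ≤ h w ^ 2 * p w := le_trans (by gcongr; exact le_self_add) h1
      rw [mul_add, sq_mul_soloPower hw]
      refine le_trans (le_of_eq ?_) h1
      ring
  calc soloPower N (h s) (r s) * (1 + snr (r w)) + soloPower N (h w) (r w)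
      ≤ p s * (1 + snr (r w)) + soloPower N (h w) (r w) := by
        gcongr
        exact soloPower_le h3
    _ = p s + (soloPower N (h w) (r w) + snr (r w) * p s) := by ring
    _ ≤ _ := by gcongr

theorem MACDecodes.snr_mul_le {N : ℝ≥0} (hN : 0 < N) {h : State} {r p : Fin 2 → ℝ≥0}
    {i j : Fin 2} (H : MACDecodes N h r p i j) :
    snr (r i) * N ≤ h i ^ 2 * p i ∧ snr (r j) * N ≤ h j ^ 2 * p j := by
  rw [macDecodes_iff hN] at H
  exact ⟨le_trans (by gcongr; exact le_self_add) H.1, H.2⟩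

theorem bcDecodes_bcPower {N : ℝ≥0} (hN : 0 < N) {h : State} {r p : Fin 2 → ℝ≥0}
    {s w : Fin 2} (hsw : w ≠ s) (hh : h w ≤ h s) (hs : snr (r s) * N ≤ h s ^ 2 * p s)
    (hw : snr (r w) * N ≤ h w ^ 2 * p w) :
    BCDecodes N h r (bcPower N s w h r) s w := by
  rw [bcDecodes_iff hN]
  simp only [bcPower, if_true, if_neg hsw]
  refine ⟨?_, ?_, (sq_mul_soloPower hs).ge⟩
  · rw [mul_add, mul_add, sq_mul_soloPower hw]
    apply le_of_eq
    ring
  -- The interference terms agree exactly, so the strong receiver only has to beat the noise, which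
  -- its larger gain ensures.
  · have : snr (r w) * N ≤ h s ^ 2 * soloPower N (h w) (r w) := by
      rw [← sq_mul_soloPower hw]
      gcongr
    rw [mul_add, mul_add, mul_left_comm]
    gcongr

theorem bcPower_add_le {N : ℝ≥0} (hN : 0 < N) {h : State} {r p : Fin 2 → ℝ≥0}
    {s w : Fin 2} (hsw : w ≠ s) (hh : h w ≤ h s)
    (H : MACDecodes N h r p s w ∨ MACDecodes N h r p w s) :
    bcPower N s w h r s + bcPower N s w h r w ≤ p s + p w := by
  simp only [bcPower, if_true, if_neg hsw]
  -- The user `a` decoded first sees interference `h b ^ 2 * p b`; a lower bound for it, written as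
  -- `h a ^ 2 * c`, costs `a` an extra power `snr (r a) * c`.
  have key : ∀ {a b : Fin 2}, MACDecodes N h r p a b → (h a ≠ 0) → ∀ c : ℝ≥0,
      h a ^ 2 * c ≤ h b ^ 2 * p b → soloPower N (h a) (r a) + snr (r a) * c ≤ p a := by
    intro a b hab ha c hc
    have h1 := ((macDecodes_iff hN).1 hab).1
    have hp : 0 < h a ^ 2 := by positivity
    refine le_of_mul_le_mul_left ?_ hp
    rw [mul_add, sq_mul_soloPower (hab.snr_mul_le hN).1, mul_left_comm, ← mul_add]
    exact le_trans (by gcongr) h1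
  rcases H with H | H
  · obtain ⟨h1, h2⟩ := H.snr_mul_le hN
    rcases eq_or_ne (h s) 0 with h0 | h0
    · have : soloPower N (h s) (r s) = 0 := by simp [soloPower, h0]
      rw [this, zero_add, mul_zero, add_zero]
      exact (soloPower_le h2).trans le_add_self
    -- With this `c` the surcharge `snr (r s) * c` is symmetric in the two signal-to-noise ratios,
    -- hence equals the broadcast surcharge of `w`.
    · have := key H h0 (snr (r w) * N / h s ^ 2) (by
        rw [mul_div_cancel₀ _ (pow_ne_zero 2 h0)]; exact h2)
      have e : snr (r s) * (snr (r w) * N / h s ^ 2) = snr (r w) * soloPower N (h s) (r s) := by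
        rw [soloPower, mul_div_assoc, mul_div_assoc]
        ring
      rw [e] at this
      calc _ = (soloPower N (h s) (r s) + snr (r w) * soloPower N (h s) (r s)) +
            soloPower N (h w) (r w) := by ring
        _ ≤ _ := add_le_add this (soloPower_le h2)
  · obtain ⟨h1, h2⟩ := H.snr_mul_le hN
    refine add_le_add (soloPower_le h2) ?_
    rcases eq_or_ne (h w) 0 with h0 | h0
    · have : snr (r w) = 0 := by simpa [h0, hN.ne'] using h1
      simp [soloPower, this]
    · refine key H h0 _ ?_
      calc h w ^ 2 * soloPower N (h s) (r s) ≤ h s ^ 2 * p s := by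
            gcongr
            exact soloPower_le h2

/-- The powers of the multiple access channel dual to broadcasting at rates `r` in state `h`. -/
def dualMACPower (N : ℝ≥0) (h : State) (r : Fin 2 → ℝ≥0) : Fin 2 → ℝ≥0 :=
  if h 1 < h 0 then macPower N 0 1 h r else macPower N 1 0 h r

/-- The powers of the broadcast channel dual to multiple access at rates `r` in state `h`. -/
def dualBCPower (N : ℝ≥0) (h : State) (r : Fin 2 → ℝ≥0) : Fin 2 → ℝ≥0 :=
  if h 1 < h 0 then bcPower N 0 1 h r else bcPower N 1 0 h r

theorem BCSupports.macSupports {N : ℝ≥0} (hN : 0 < N) {h : State} {r p : Fin 2 → ℝ≥0}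
    (H : BCSupports N h r p) : MACSupports N h r (dualMACPower N h r) := by
  rcases H with ⟨hh, H⟩ | ⟨hh, H⟩
  · rw [dualMACPower, if_pos hh]
    exact .inl (macDecodes_macPower hN (by decide) H)
  · rw [dualMACPower, if_neg hh.not_gt]
    exact .inr (macDecodes_macPower hN (by decide) H)

theorem BCSupports.dualMACPower_add_le {N : ℝ≥0} (hN : 0 < N) {h : State} {r p : Fin 2 → ℝ≥0}
    (H : BCSupports N h r p) : dualMACPower N h r 0 + dualMACPower N h r 1 ≤ p 0 + p 1 := by
  rcases H with ⟨hh, H⟩ | ⟨hh, H⟩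
  · rw [dualMACPower, if_pos hh]
    exact macPower_add_le hN (by decide) H
  · rw [dualMACPower, if_neg hh.not_gt, add_comm, add_comm (p 0)]
    exact macPower_add_le hN (by decide) H

theorem MACSupports.snr_mul_le {N : ℝ≥0} (hN : 0 < N) {h : State} {r p : Fin 2 → ℝ≥0}
    (H : MACSupports N h r p) (i : Fin 2) : snr (r i) * N ≤ h i ^ 2 * p i := by
  rcases H with H | H
  · have := H.snr_mul_le hN
    fin_cases i
    exacts [this.1, this.2]
  · have := H.snr_mul_le hN
    fin_cases i
    exacts [this.2, this.1]

theorem MACSupports.bcSupports {N : ℝ≥0} (hN : 0 < N) {h : State} {r p : Fin 2 → ℝ≥0}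
    (H : MACSupports N h r p) : BCSupports N h r (dualBCPower N h r) := by
  have := H.snr_mul_le hN
  by_cases hh : h 1 < h 0
  · rw [dualBCPower, if_pos hh]
    exact .inl ⟨hh, bcDecodes_bcPower hN (by decide) hh.le (this _) (this _)⟩
  · rw [dualBCPower, if_neg hh]
    exact .inr ⟨not_lt.1 hh, bcDecodes_bcPower hN (by decide) (not_lt.1 hh) (this _) (this _)⟩

theorem MACSupports.dualBCPower_add_le {N : ℝ≥0} (hN : 0 < N) {h : State} {r p : Fin 2 → ℝ≥0}
    (H : MACSupports N h r p) : dualBCPower N h r 0 + dualBCPower N h r 1 ≤ p 0 + p 1 := by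
  by_cases hh : h 1 < h 0
  · rw [dualBCPower, if_pos hh]
    exact bcPower_add_le hN (by decide) hh.le H
  · rw [dualBCPower, if_neg hh, add_comm, add_comm (p 0)]
    exact bcPower_add_le hN (by decide) (not_lt.1 hh) H.symm

theorem macSupports_zero (N : ℝ≥0) (h : State) : MACSupports N h 0 0 := by
  left
  simp [MACDecodes, gaussianRate]

/-- The silenced user is decoded first, which is trivial at rate zero, and leaves no interference
for the other. -/
theorem MACSupports.update_zero {N : ℝ≥0} (hN : 0 < N) {h : State} {r p : Fin 2 → ℝ≥0}
    (H : MACSupports N h r p) (i : Fin 2) :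
    MACSupports N h (Function.update r i 0) (Function.update p i 0) := by
  have := H.snr_mul_le hN
  fin_cases i
  · left
    rw [macDecodes_iff hN]
    simpa [snr_zero] using this 1
  · right
    rw [macDecodes_iff hN]
    simpa [snr_zero] using this 0

/-! ### Measurability of the dual powers, and operations on policies. -/

theorem measurable_soloPower (N : ℝ≥0) (i : Fin 2) :
    Measurable fun x : State × (Fin 2 → ℝ≥0) => soloPower N (x.1 i) (x.2 i) := by
  have := measurable_snr
  unfold soloPower
  fun_prop

theorem measurable_macPower (N : ℝ≥0) (s w : Fin 2) :
    Measurable (Function.uncurry (macPower N s w)) := by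
  have h1 := measurable_soloPower N
  have h2 := measurable_snr
  refine measurable_pi_lambda _ fun k => ?_
  simp only [Function.uncurry, macPower]
  split_ifs
  · exact (h1 s).mul (by fun_prop)
  · exact h1 w

theorem measurable_bcPower (N : ℝ≥0) (s w : Fin 2) :
    Measurable (Function.uncurry (bcPower N s w)) := by
  have h1 := measurable_soloPower N
  have h2 := measurable_snr
  refine measurable_pi_lambda _ fun k => ?_
  simp only [Function.uncurry, bcPower]
  split_ifs
  · exact h1 s
  · exact (h1 w).add (Measurable.mul (by fun_prop) (h1 s))

theorem measurableSet_stronger :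
    MeasurableSet {x : State × (Fin 2 → ℝ≥0) | x.1 1 < x.1 0} :=
  measurableSet_lt (by fun_prop) (by fun_prop)

theorem measurable_dualMACPower (N : ℝ≥0) : Measurable (Function.uncurry (dualMACPower N)) :=
  (measurable_macPower N 0 1).ite measurableSet_stronger (measurable_macPower N 1 0)

theorem measurable_dualBCPower (N : ℝ≥0) : Measurable (Function.uncurry (dualBCPower N)) :=
  (measurable_bcPower N 0 1).ite measurableSet_stronger (measurable_bcPower N 1 0)

/-- The same rates, with powers chosen from the current state and the rates. -/
def Policy.withPower (π : Policy) {Q : State → (Fin 2 → ℝ≥0) → Fin 2 → ℝ≥0}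
    (hQ : Measurable (Function.uncurry Q)) : Policy where
  rate := π.rate
  power t h u := Q (h (Fin.last t)) (π.rate t h u)
  measurable_rate := π.measurable_rate
  measurable_power t := hQ.comp (Measurable.prodMk (by fun_prop) (π.measurable_rate t))

/-- User `i` never transmits, the other user does not change. -/
def Policy.silence (π : Policy) (i : Fin 2) : Policy where
  rate t h u := Function.update (π.rate t h u) i 0
  power t h u := Function.update (π.power t h u) i 0
  measurable_rate t := measurable_update_left.comp (π.measurable_rate t)
  measurable_power t := measurable_update_left.comp (π.measurable_power t)

/-- Nobody ever transmits. -/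
def Policy.idle : Policy where
  rate _ _ _ := 0
  power _ _ _ := 0
  measurable_rate _ := measurable_const
  measurable_power _ := measurable_const

/-- The states of the last `s + 1` slots among the slots `0, …, t`. -/
def recent {s t : ℕ} (hst : s ≤ t) (h : Fin (t + 1) → State) : Fin (s + 1) → State :=
  fun k => h ⟨k + (t - s), by omega⟩

/-- In every slot `t ≥ s`, act as `π` does in slot `s`, on the states of the last `s + 1` slots. -/
def Policy.sliding (π : Policy) (s : ℕ) : Policy where
  rate t h u := if hst : s ≤ t then π.rate s (recent hst h) u else 0
  power t h u := if hst : s ≤ t then π.power s (recent hst h) u else 0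
  measurable_rate t := by
    by_cases hst : s ≤ t
    · simp only [hst, dite_true]
      exact (π.measurable_rate s).comp
        (f := fun y : (Fin (t + 1) → State) × unitInterval => (recent hst y.1, y.2))
        (by unfold recent; fun_prop)
    · simp only [hst, dite_false]
      fun_prop
  measurable_power t := by
    by_cases hst : s ≤ t
    · simp only [hst, dite_true]
      exact (π.measurable_power s).comp
        (f := fun y : (Fin (t + 1) → State) × unitInterval => (recent hst y.1, y.2))
        (by unfold recent; fun_prop)
    · simp only [hst, dite_false]
      fun_prop

/-- The policy drawn by `φ` from the seed, run with the fresh seed given by `φ`. -/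
def Policy.select {ι : Type} [Finite ι] [MeasurableSpace ι] [DiscreteMeasurableSpace ι]
    (π : ι → Policy)
    (φ : unitInterval → ι × unitInterval) (hφ : Measurable φ) : Policy where
  rate t h u := (π (φ u).1).rate t h (φ u).2
  power t h u := (π (φ u).1).power t h (φ u).2
  measurable_rate t := by
    have : Measurable fun y : ι × (Fin (t + 1) → State) × unitInterval =>
        (π y.1).rate t y.2.1 y.2.2 :=
      measurable_from_prod_countable_right fun i => (π i).measurable_rate t
    exact this.comp (f := fun y : (Fin (t + 1) → State) × unitInterval =>
       ((φ y.2).1, y.1, (φ y.2).2)) (by fun_prop)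
  measurable_power t := by
    have : Measurable fun y : ι × (Fin (t + 1) → State) × unitInterval =>
        (π y.1).power t y.2.1 y.2.2 :=
      measurable_from_prod_countable_right fun i => (π i).measurable_power t
    exact this.comp (f := fun y : (Fin (t + 1) → State) × unitInterval =>
       ((φ y.2).1, y.1, (φ y.2).2)) (by fun_prop)

theorem Policy.measurable_rateAt (π : Policy) (t : ℕ) : Measurable (π.rateAt t) :=
  (π.measurable_rate t).comp
    (f := fun ω : Path × unitInterval => (fun k : Fin (t + 1) => ω.1 k, ω.2))
    (by fun_prop)

theorem Policy.measurable_powerAt (π : Policy) (t : ℕ) : Measurable (π.powerAt t) :=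
  (π.measurable_power t).comp
    (f := fun ω : Path × unitInterval => (fun k : Fin (t + 1) => ω.1 k, ω.2))
    (by fun_prop)

theorem shift_iterate (m : ℕ) (x : Path) (k : ℕ) : shift^[m] x k = x (k + m) := by
  induction m generalizing x with
  | zero => rfl
  | succ m ih => rw [Function.iterate_succ_apply, ih, shift]; congr 1

theorem Policy.sliding_rateAt (π : Policy) {s t : ℕ} (hst : s ≤ t) (ω : Path × unitInterval) :
    (π.sliding s).rateAt t ω = π.rateAt s (shift^[t - s] ω.1, ω.2) := by
  have : recent hst (fun k => ω.1 k) = fun k : Fin (s + 1) => shift^[t - s] ω.1 k :=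
    funext fun k => (shift_iterate _ _ _).symm
  simp [Policy.rateAt, sliding, hst, this]

theorem Policy.sliding_powerAt (π : Policy) {s t : ℕ} (hst : s ≤ t) (ω : Path × unitInterval) :
    (π.sliding s).powerAt t ω = π.powerAt s (shift^[t - s] ω.1, ω.2) := by
  have : recent hst (fun k => ω.1 k) = fun k : Fin (s + 1) => shift^[t - s] ω.1 k :=
    funext fun k => (shift_iterate _ _ _).symm
  simp [Policy.powerAt, sliding, hst, this]

theorem Policy.sliding_rateAt_of_lt (π : Policy) {s t : ℕ} (hst : t < s)
    (ω : Path × unitInterval) : (π.sliding s).rateAt t ω = 0 := by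
  simp [Policy.rateAt, sliding, hst.not_ge]

theorem Policy.sliding_powerAt_of_lt (π : Policy) {s t : ℕ} (hst : t < s)
    (ω : Path × unitInterval) : (π.sliding s).powerAt t ω = 0 := by
  simp [Policy.powerAt, sliding, hst.not_ge]

/-! ### Expected rates and powers under time shifts and randomization. -/

namespace FadingModel

variable (M : FadingModel)

instance : IsProbabilityMeasure M.channel := M.isProbabilityMeasure

instance : IsProbabilityMeasure M.law := by unfold law; infer_instance

/-- The policy obeys the codebooks and every codeword of a multiple access channel is decoded. -/
def Feasible (π : Policy) : Prop :=
  M.UsesRates π ∧ ∀ t ω, MACSupports M.noise (ω.1 t) (π.rateAt t ω) (π.powerAt t ω)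

/-- The expected rate of user `i` in slot `t`. -/
def meanRate (π : Policy) (t : ℕ) (i : Fin 2) : ℝ≥0∞ := ∫⁻ ω, (π.rateAt t ω i : ℝ≥0∞) ∂M.law

/-- The expected power of user `i` in slot `t`. -/
def meanPower (π : Policy) (t : ℕ) (i : Fin 2) : ℝ≥0∞ := ∫⁻ ω, (π.powerAt t ω i : ℝ≥0∞) ∂M.law

theorem integral_rateAt (π : Policy) (t : ℕ) (i : Fin 2) :
    ∫ ω, (π.rateAt t ω i : ℝ) ∂M.law = (M.meanRate π t i).toReal := by
  have := π.measurable_rateAt t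
  rw [integral_eq_lintegral_of_nonneg_ae (by filter_upwards; simp) (by fun_prop), meanRate]
  simp

theorem measurePreserving_shift_iterate (m : ℕ) :
    MeasurePreserving (fun ω : Path × unitInterval => (shift^[m] ω.1, ω.2)) M.law M.law :=
  (M.ergodic.toMeasurePreserving.iterate m).prod (MeasurePreserving.id _)

theorem meanRate_sliding (π : Policy) {s t : ℕ} (hst : s ≤ t) (i : Fin 2) :
    M.meanRate (π.sliding s) t i = M.meanRate π s i := by
  have := π.measurable_rateAt s
  simp only [meanRate, π.sliding_rateAt hst]
  exact (M.measurePreserving_shift_iterate (t - s)).lintegral_comp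
    (f := fun ω => (π.rateAt s ω i : ℝ≥0∞)) (by fun_prop)

/-- Stationarity gives equality from slot `s` on; before that the sliding policy is idle. -/
theorem meanPower_sliding_le (π : Policy) (s t : ℕ) (i : Fin 2) :
    M.meanPower (π.sliding s) t i ≤ M.meanPower π s i := by
  have := π.measurable_powerAt s
  rcases le_or_gt s t with hst | hst
  · simp only [meanPower, π.sliding_powerAt hst]
    exact ((M.measurePreserving_shift_iterate (t - s)).lintegral_comp
      (f := fun ω => (π.powerAt s ω i : ℝ≥0∞)) (by fun_prop)).le
  · simp [meanPower, π.sliding_powerAt_of_lt hst]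

theorem feasible_idle : M.Feasible Policy.idle :=
  ⟨fun _ _ i => M.zero_mem_rates i, fun _ _ => macSupports_zero _ _⟩

variable {M}

theorem Feasible.silence {π : Policy} (h : M.Feasible π) (i : Fin 2) :
    M.Feasible (π.silence i) := by
  refine ⟨fun t ω j => ?_, fun t ω => (h.2 t ω).update_zero M.noise_pos i⟩
  change Function.update (π.rateAt t ω) i 0 j ∈ _
  rcases eq_or_ne j i with rfl | hj
  · simpa using M.zero_mem_rates j
  · simpa [hj] using h.1 t ω j

theorem Feasible.sliding {π : Policy} (h : M.Feasible π) (s : ℕ) : M.Feasible (π.sliding s) := by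
  refine ⟨fun t ω j => ?_, fun t ω => ?_⟩
  · rcases le_or_gt s t with hst | hst
    · rw [π.sliding_rateAt hst]
      exact h.1 _ _ _
    · rw [π.sliding_rateAt_of_lt hst]
      exact M.zero_mem_rates j
  · rcases le_or_gt s t with hst | hst
    · rw [π.sliding_rateAt hst, π.sliding_powerAt hst]
      -- Slot `s` of the shifted path is the present slot, so the codewords are decoded in the
      -- actual state.
      have : shift^[t - s] ω.1 s = ω.1 t := by rw [shift_iterate, Nat.add_sub_cancel' hst]
      exact this ▸ h.2 s (shift^[t - s] ω.1, ω.2)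
    · rw [π.sliding_rateAt_of_lt hst, π.sliding_powerAt_of_lt hst]
      exact macSupports_zero _ _

/-- Every random choice among finitely many policies is itself a policy. -/
theorem exists_mixture {ι : Type} [Fintype ι] [Nonempty ι] (π : ι → Policy)
    (hπ : ∀ i, M.Feasible (π i)) (w : ι → ℝ≥0) (hw : ∑ i, w i = 1) :
    ∃ ρ : Policy, M.Feasible ρ ∧
      (∀ t j, M.meanRate ρ t j = ∑ i, w i * M.meanRate (π i) t j) ∧
      ∀ t j, M.meanPower ρ t j = ∑ i, w i * M.meanPower (π i) t j := by
  let _ : MeasurableSpace ι := ⊤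
  have : DiscreteMeasurableSpace ι := ⟨fun _ => trivial⟩
  let ν : Measure ι := ∑ i, (w i : ℝ≥0∞) • Measure.dirac i
  have : IsProbabilityMeasure ν := ⟨by
    simp only [ν, Measure.coe_finsetSum, Finset.sum_apply, Measure.smul_apply, measure_univ,
      smul_eq_mul, mul_one]
    exact_mod_cast hw⟩
  -- A uniform seed can be mapped to any law on a standard Borel space: here a random index together
  -- with an independent fresh uniform seed.
  obtain ⟨φ, hφ, hmap⟩ := (ν.prod (volume : Measure unitInterval)).exists_measurable_map_eq
  have hlaw : MeasurePreserving (fun ω : Path × unitInterval => (ω.1, φ ω.2)) M.law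
      (M.channel.prod (ν.prod volume)) :=
    (MeasurePreserving.id _).prod ⟨hφ, hmap⟩
  have key : ∀ f : ι → Path × unitInterval → ℝ≥0∞, (∀ i, Measurable (f i)) →
      ∫⁻ ω, f (φ ω.2).1 (ω.1, (φ ω.2).2) ∂M.law = ∑ i, w i * ∫⁻ ω, f i ω ∂M.law := by
    intro f hf
    have hf1 : Measurable fun y : ι × Path × unitInterval => f y.1 y.2 :=
      measurable_from_prod_countable_right hf
    have hf2 : Measurable fun y : Path × ι × unitInterval => f y.2.1 (y.1, y.2.2) :=
      hf1.comp (f := fun y : Path × ι × unitInterval => (y.2.1, y.1, y.2.2)) (by fun_prop)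
    rw [hlaw.lintegral_comp (f := fun y => f y.2.1 (y.1, y.2.2)) hf2,
      lintegral_prod _ hf2.aemeasurable]
    have h1 : ∀ x, ∫⁻ y, f y.1 (x, y.2) ∂(ν.prod volume)
        = ∑ i, (w i : ℝ≥0∞) * ∫⁻ u, f i (x, u) ∂volume := by
      intro x
      have h0 : Measurable fun y : ι × unitInterval => f y.1 (x, y.2) :=
        hf2.comp measurable_prodMk_left
      rw [lintegral_prod _ h0.aemeasurable]
      simp only [ν, lintegral_finsetSum_measure, lintegral_smul_measure, lintegral_dirac,
        smul_eq_mul]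
    simp only [h1]
    rw [lintegral_finsetSum]
    · refine Finset.sum_congr rfl fun i _ => ?_
      rw [lintegral_const_mul, law, lintegral_prod _ (hf i).aemeasurable]
      exact (hf i).lintegral_prod_right'
    · exact fun i _ => (hf i).lintegral_prod_right'.const_mul _
  refine ⟨Policy.select π φ hφ, ⟨fun t ω => (hπ (φ ω.2).1).1 t (ω.1, (φ ω.2).2),
    fun t ω => (hπ (φ ω.2).1).2 t (ω.1, (φ ω.2).2)⟩, fun t j => ?_, fun t j => ?_⟩
  · exact key (fun i ω => (π i).rateAt t ω j) fun i => by
      have := (π i).measurable_rateAt t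
      fun_prop
  · exact key (fun i ω => (π i).powerAt t ω j) fun i => by
      have := (π i).measurable_powerAt t
      fun_prop

end FadingModel

/-! ### Average rates achievable with a fixed power split. -/

theorem tendsto_average {u : ℕ → ℝ} {l : ℝ} (h : Tendsto u atTop (𝓝 l)) :
    Tendsto (fun T : ℕ => (∑ t ∈ Finset.range T, u t) / (T : ℝ)) atTop (𝓝 l) := by
  simpa [div_eq_inv_mul] using h.cesaro

/-- Convexity of the exponential gives `2 ^ r - 1 ≥ r log 2`, and `log 2 ≥ 1/2`. This bounds rates
linearly by received power. -/
theorem le_two_mul_snr (r : ℝ≥0) : r ≤ 2 * snr r := by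
  rw [← NNReal.coe_le_coe, NNReal.coe_mul, coe_snr, Real.rpow_def_of_pos two_pos]
  have h1 := Real.add_one_le_exp (Real.log 2 * r)
  have h2 : (0.5 : ℝ) * r ≤ Real.log 2 * r := by
    gcongr
    linarith [Real.log_two_gt_d9]
  push_cast
  linarith

namespace FadingModel

variable {M : FadingModel}

variable (M) in
/-- The average rates `y` are attained by a multiple access policy with average powers `q`. -/
def Achieves (q : Fin 2 → ℝ≥0) (y : Fin 2 → ℝ) : Prop :=
  ∃ π, M.Feasible π ∧ (∀ i t, M.meanPower π t i ≤ q i) ∧ M.IsAverageRate π y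

theorem isAverageRate_iff {π : Policy} {y : Fin 2 → ℝ} :
    M.IsAverageRate π y ↔ ∀ i, Tendsto
      (fun T : ℕ => (∑ t ∈ Finset.range T, (M.meanRate π t i).toReal) / (T : ℝ))
      atTop (𝓝 (y i)) := by
  simp only [IsAverageRate, integral_rateAt]

theorem UsesRates.rateAt_le {π : Policy} (h : M.UsesRates π) (t : ℕ)
    (ω : Path × unitInterval) (i : Fin 2) : π.rateAt t ω i ≤ (M.rates i).sup id :=
  Finset.le_sup (f := id) (h t ω i)

theorem UsesRates.meanRate_ne_top {π : Policy} (h : M.UsesRates π) (t : ℕ) (i : Fin 2) :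
    M.meanRate π t i ≠ ∞ := by
  refine ne_top_of_le_ne_top (b := ((M.rates i).sup id : ℝ≥0)) ENNReal.coe_ne_top ?_
  refine (lintegral_mono (g := fun _ => (((M.rates i).sup id : ℝ≥0) : ℝ≥0∞)) fun ω => ?_).trans
    (by simp)
  exact ENNReal.coe_le_coe.2 (h.rateAt_le t ω i)

variable (M) in
/-- The probability that the gain of user `i` exceeds `K`. -/
def tail (i : Fin 2) (K : ℕ) : ℝ≥0∞ := M.law {ω | (K : ℝ≥0) < ω.1 0 i}

theorem measurableSet_gain_gt (t : ℕ) (i : Fin 2) (K : ℕ) :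
    MeasurableSet {ω : Path × unitInterval | (K : ℝ≥0) < ω.1 t i} :=
  measurableSet_lt (by fun_prop) (by fun_prop)

/-- Gains are finite, so these events decrease to the empty set. -/
theorem tendsto_tail (i : Fin 2) : Tendsto (M.tail i) atTop (𝓝 0) := by
  have h := tendsto_measure_iInter_atTop (μ := M.law)
    (s := fun K : ℕ => {ω : Path × unitInterval | (K : ℝ≥0) < ω.1 0 i})
    (fun K => (measurableSet_gain_gt 0 i K).nullMeasurableSet)
    (fun K L hKL ω (hω : (L : ℝ≥0) < ω.1 0 i) =>
      show (K : ℝ≥0) < ω.1 0 i from lt_of_le_of_lt (Nat.cast_le.2 hKL) hω) ⟨0, measure_ne_top _ _⟩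
  have e : (⋂ K : ℕ, {ω : Path × unitInterval | (K : ℝ≥0) < ω.1 0 i}) = ∅ := by
    ext ω
    simp only [Set.mem_iInter, Set.mem_ofPred_eq, Set.mem_empty_iff_false, iff_false, not_forall,
      not_lt]
    exact exists_nat_ge _
  rwa [e, measure_empty] at h

theorem law_gain_gt (t : ℕ) (i : Fin 2) (K : ℕ) :
    M.law {ω | (K : ℝ≥0) < ω.1 t i} = M.tail i K := by
  rw [tail, ← (M.measurePreserving_shift_iterate t).measure_preimage
    (measurableSet_gain_gt 0 i K).nullMeasurableSet]
  simp [Set.preimage, shift_iterate]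

/-- Gains may be unbounded, so they are truncated at `K`: above `K` the largest codebook rate is the
bound, below `K` the rate is at most linear in the power. -/
theorem Feasible.meanRate_le {π : Policy} (h : M.Feasible π) (t : ℕ) (i : Fin 2) (K : ℕ) :
    M.meanRate π t i ≤ ((M.rates i).sup id : ℝ≥0) * M.tail i K +
      (2 * K ^ 2 / M.noise : ℝ≥0) * M.meanPower π t i := by
  have hm := π.measurable_powerAt t
  rw [← M.law_gain_gt t i K, meanPower,
    ← lintegral_indicator_const (measurableSet_gain_gt t i K),
    ← lintegral_const_mul _ (by fun_prop),
    ← lintegral_add_right _ (by fun_prop)]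
  refine lintegral_mono fun ω => ?_
  simp only [Set.indicator, Set.mem_ofPred_eq]
  split_ifs with hK
  · refine le_trans ?_ le_self_add
    exact_mod_cast h.1.rateAt_le t ω i
  · rw [zero_add]
    norm_cast
    have h1 := (h.2 t ω).snr_mul_le M.noise_pos i
    rw [div_mul_eq_mul_div, le_div_iff₀ M.noise_pos]
    calc π.rateAt t ω i * M.noise ≤ 2 * snr (π.rateAt t ω i) * M.noise := by
          gcongr
          exact le_two_mul_snr _
      _ = 2 * (snr (π.rateAt t ω i) * M.noise) := by ring
      _ ≤ 2 * (ω.1 t i ^ 2 * π.powerAt t ω i) := by gcongr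
      _ ≤ 2 * ((K : ℝ≥0) ^ 2 * π.powerAt t ω i) := by
          gcongr
          exact not_lt.1 hK
      _ = _ := by push_cast; ring

theorem Achieves.nonneg {q : Fin 2 → ℝ≥0} {y : Fin 2 → ℝ} (h : M.Achieves q y) (i : Fin 2) :
    0 ≤ y i := by
  obtain ⟨π, -, -, h3⟩ := h
  exact ge_of_tendsto' (isAverageRate_iff.1 h3 i) fun T => by positivity

theorem Achieves.le {q : Fin 2 → ℝ≥0} {y : Fin 2 → ℝ} (h : M.Achieves q y) (i : Fin 2) (K : ℕ) :
    y i ≤ ((M.rates i).sup id : ℝ≥0) * (M.tail i K).toReal +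
      (2 * K ^ 2 / M.noise : ℝ≥0) * (q i : ℝ) := by
  obtain ⟨π, h1, h2, h3⟩ := h
  have htail : M.tail i K ≠ ∞ := measure_ne_top _ _
  have hb (t : ℕ) : (M.meanRate π t i).toReal ≤ ((M.rates i).sup id : ℝ≥0) * (M.tail i K).toReal +
      (2 * K ^ 2 / M.noise : ℝ≥0) * (q i : ℝ) := by
    have hle := (h1.meanRate_le t i K).trans (add_le_add_right (mul_le_mul_right (h2 i t) _) _)
    have := ENNReal.toReal_mono (by finiteness) hle
    rwa [ENNReal.toReal_add (by finiteness) (by finiteness), ENNReal.toReal_mul,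
      ENNReal.toReal_mul] at this
  refine le_of_tendsto (isAverageRate_iff.1 h3 i) ?_
  filter_upwards [eventually_gt_atTop 0] with T hT
  rw [div_le_iff₀ (by positivity), mul_comm]
  rw [← nsmul_eq_mul]
  simpa only [Finset.card_range] using
    Finset.sum_le_card_nsmul (Finset.range T) _ _ fun t _ => hb t

theorem Achieves.mono {q q' : Fin 2 → ℝ≥0} {y : Fin 2 → ℝ} (h : M.Achieves q y) (hq : q ≤ q') :
    M.Achieves q' y := by
  obtain ⟨π, h1, h2, h3⟩ := h
  exact ⟨π, h1, fun i t => (h2 i t).trans (by exact_mod_cast hq i), h3⟩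

/-- The policy is run with probability `c`, and all users idle otherwise. -/
theorem Achieves.smul {q : Fin 2 → ℝ≥0} {y : Fin 2 → ℝ} (h : M.Achieves q y) {c : ℝ≥0}
    (hc : c ≤ 1) : M.Achieves (c • q) ((c : ℝ) • y) := by
  obtain ⟨π, h1, h2, h3⟩ := h
  obtain ⟨ρ, hρ, hr, hp⟩ := exists_mixture ![π, Policy.idle]
    (by intro i; fin_cases i; exacts [h1, M.feasible_idle]) ![c, 1 - c]
    (by simp [add_tsub_cancel_of_le hc])
  have hr' : ∀ t j, M.meanRate ρ t j = c * M.meanRate π t j := by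
    intro t j
    have : M.meanRate Policy.idle t j = 0 := by simp [meanRate, Policy.rateAt, Policy.idle]
    simp [hr, Fin.sum_univ_two, this]
  have hp' : ∀ t j, M.meanPower ρ t j = c * M.meanPower π t j := by
    intro t j
    have : M.meanPower Policy.idle t j = 0 := by simp [meanPower, Policy.powerAt, Policy.idle]
    simp [hp, Fin.sum_univ_two, this]
  refine ⟨ρ, hρ, fun i t => ?_, isAverageRate_iff.2 fun i => ?_⟩
  · rw [hp']
    simpa using mul_le_mul_right (h2 i t) (c : ℝ≥0∞)
  · simpa [hr', ← Finset.mul_sum, mul_div_assoc] using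
      (isAverageRate_iff.1 h3 i).const_mul (c : ℝ)

theorem Achieves.update_zero {q : Fin 2 → ℝ≥0} {y : Fin 2 → ℝ} (h : M.Achieves q y)
    (i : Fin 2) : M.Achieves (Function.update q i 0) (Function.update y i 0) := by
  obtain ⟨π, h1, h2, h3⟩ := h
  have hr : ∀ t ω, (π.silence i).rateAt t ω = Function.update (π.rateAt t ω) i 0 :=
    fun _ _ => rfl
  have hp : ∀ t ω, (π.silence i).powerAt t ω = Function.update (π.powerAt t ω) i 0 :=
    fun _ _ => rfl
  refine ⟨π.silence i, h1.silence i, fun j t => ?_, fun j => ?_⟩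
  · rcases eq_or_ne j i with rfl | hj
    · simp [meanPower, hp]
    · simpa [meanPower, hp, hj] using h2 j t
  · rcases eq_or_ne j i with rfl | hj
    · simp [hr]
    · simpa [hr, hj] using h3 j

/-- The rates averaged over the first `T` slots are the long-run rates of a policy whose expected
powers are averaged over these slots. -/
theorem Feasible.exists_average {π : Policy} (h : M.Feasible π) {T : ℕ} (hT : 0 < T) :
    ∃ ρ, M.Feasible ρ ∧
      (∀ i t, M.meanPower ρ t i ≤ ∑ s : Fin T, ((T : ℝ≥0)⁻¹ : ℝ≥0) * M.meanPower π s i) ∧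
      M.IsAverageRate ρ fun i =>
        (∑ t ∈ Finset.range T, (M.meanRate π t i).toReal) / (T : ℝ) := by
  have : Nonempty (Fin T) := ⟨⟨0, hT⟩⟩
  have hT' : (T : ℝ≥0) ≠ 0 := by positivity
  obtain ⟨ρ, hρ, hr, hp⟩ := exists_mixture (fun s : Fin T => π.sliding s)
    (fun s => h.sliding s) (fun _ => (T : ℝ≥0)⁻¹) (by simp [hT'])
  refine ⟨ρ, hρ, fun i t => ?_, isAverageRate_iff.2 fun i => tendsto_average ?_⟩
  · rw [hp]
    gcongr
    exact M.meanPower_sliding_le π _ t _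
  -- From slot `T` on all the sliding policies are active, so the expected rate is constant there;
  -- earlier slots do not affect the limit.
  · refine tendsto_const_nhds.congr' ?_
    filter_upwards [eventually_ge_atTop T] with t ht
    have e : ∀ s : Fin T, M.meanRate (π.sliding s) t i = M.meanRate π s i :=
      fun s => M.meanRate_sliding π (by omega) i
    have hfin := fun s : ℕ => h.1.meanRate_ne_top s i
    simp only [hr, e]
    rw [ENNReal.toReal_sum fun (s : Fin T) _ => ENNReal.mul_ne_top ENNReal.coe_ne_top (hfin s)]
    simp only [ENNReal.toReal_mul, ← Finset.mul_sum]
    rw [Finset.sum_range, div_eq_inv_mul]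
    simp

/-- The average rates that are achievable with powers `q` depend on `q` in a closed way. -/
theorem mem_closure_achieves {q : ℕ → Fin 2 → ℝ≥0} {y : ℕ → Fin 2 → ℝ} {P : ℝ≥0}
    {q' : Fin 2 → ℝ≥0} {x : Fin 2 → ℝ} (hqy : ∀ n, M.Achieves (q n) (y n))
    (hP : ∀ n, q n 0 + q n 1 = P) (hq : Tendsto q atTop (𝓝 q')) (hy : Tendsto y atTop (𝓝 x)) :
    x ∈ closure {z | M.Achieves q' z} := by
  have hq' := tendsto_pi_nhds.1 hq
  have hy' := tendsto_pi_nhds.1 hy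
  have hP' : q' 0 + q' 1 = P :=
    tendsto_nhds_unique ((hq' 0).add (hq' 1)) (by simp [hP])
  by_cases hz : ∃ i, q' i = 0
  · obtain ⟨i, hi⟩ := hz
    have hxi : x i = 0 := by
      apply le_antisymm
      -- For fixed `K` the power term vanishes as `n → ∞`; then `K → ∞` removes the tail. A user
      -- whose power tends to zero has limit rate zero and can be silenced.
      · have h1 (K : ℕ) : x i ≤ ((M.rates i).sup id : ℝ≥0) * (M.tail i K).toReal := by
          refine le_of_tendsto_of_tendsto' (hy' i) ?_ fun n => (hqy n).le i K
          have := (NNReal.tendsto_coe.2 (hq' i)).const_mul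
            ((2 * K ^ 2 / M.noise : ℝ≥0) : ℝ)
          simpa [hi] using this.const_add
            ((((M.rates i).sup id : ℝ≥0) : ℝ) * (M.tail i K).toReal)
        have h2 := (ENNReal.tendsto_toReal ENNReal.zero_ne_top).comp (M.tendsto_tail i)
        have h3 := h2.const_mul (((M.rates i).sup id : ℝ≥0) : ℝ)
        exact ge_of_tendsto' (by simpa using h3) h1
      · exact ge_of_tendsto' (hy' i) fun n => (hqy n).nonneg i
    have hlim : Tendsto (fun n => Function.update (y n) i 0) atTop (𝓝 x) := by
      have := hy.update i (tendsto_const_nhds (x := (0 : ℝ)))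
      have e : Function.update x i 0 = x := by rw [← hxi, Function.update_eq_self]
      rwa [e] at this
    refine mem_closure_of_tendsto hlim (Eventually.of_forall fun n => ?_)
    refine ((hqy n).update_zero i).mono fun j => ?_
    rcases eq_or_ne j i with rfl | hj
    · simp
    -- The other user receives the whole budget in the limit, so its power `q n j` is already
    -- allowed.
    · have hjP : q' j = P := by
        rw [← hP']
        fin_cases i <;> fin_cases j <;> simp_all
      have : q n j ≤ P := by
        rw [← hP n]
        fin_cases j
        exacts [le_self_add, le_add_self]
      simpa [hj, hjP] using this
  · push Not at hz
    -- Scaling by `c n` brings `q n` below `q'`. A zero `q n i` makes `c n = 0`, which is harmless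
    -- since only the limit `c n → 1` matters.
    let c : ℕ → ℝ≥0 := fun n => min 1 (min (q' 0 / q n 0) (q' 1 / q n 1))
    have hc : Tendsto c atTop (𝓝 1) := by
      have h1 (i : Fin 2) : Tendsto (fun n => q' i / q n i) atTop (𝓝 1) := by
        have := (tendsto_const_nhds (x := q' i)).div (hq' i) (hz i)
        rwa [div_self (hz i)] at this
      simpa using (tendsto_const_nhds (x := (1 : ℝ≥0))).min ((h1 0).min (h1 1))
    have hlim : Tendsto (fun n => (c n : ℝ) • y n) atTop (𝓝 x) := by
      simpa using (NNReal.tendsto_coe.2 hc).smul hy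
    refine mem_closure_of_tendsto hlim (Eventually.of_forall fun n => ?_)
    refine ((hqy n).smul (min_le_left _ _)).mono fun i => ?_
    have hci : c n ≤ q' i / q n i := by
      refine (min_le_right _ _).trans ?_
      fin_cases i
      exacts [min_le_left _ _, min_le_right _ _]
    calc c n * q n i ≤ q' i / q n i * q n i := by gcongr
      _ ≤ q' i := by
          rcases eq_or_ne (q n i) 0 with h0 | h0
          · simp [h0]
          · rw [div_mul_cancel₀ _ h0]

end FadingModel

/-! ### Passing between the broadcast network and its duals. -/

theorem MACNetwork.stabilityRegion_eq (N : MACNetwork) :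
    N.stabilityRegion = closure {y | N.toFadingModel.Achieves N.power y} := by
  simp only [stabilityRegion, Admissible, FadingModel.Achieves, FadingModel.Feasible,
    FadingModel.meanPower, and_assoc]

/-- Time averaging turns a broadcast policy into a multiple access policy with a fixed split of the
power between the users. -/
theorem BCNetwork.Admissible.exists_achieves {B : BCNetwork} {π : Policy} (h : B.Admissible π)
    {T : ℕ} (hT : 0 < T) :
    ∃ q : Fin 2 → ℝ≥0, q 0 + q 1 = B.power ∧ B.toFadingModel.Achieves q fun i =>
      (∑ t ∈ Finset.range T, ∫ ω, (π.rateAt t ω i : ℝ) ∂B.law) / (T : ℝ) := by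
  obtain ⟨h1, h2, h3⟩ := h
  let π' := π.withPower (measurable_dualMACPower B.noise)
  have hπ' : B.toFadingModel.Feasible π' :=
    ⟨h1, fun t ω => (h2 t ω).macSupports B.noise_pos⟩
  have hpow (t : ℕ) : B.meanPower π' t 0 + B.meanPower π' t 1 ≤ B.power := by
    have hm := π'.measurable_powerAt t
    rw [FadingModel.meanPower, FadingModel.meanPower, ← lintegral_add_left (by fun_prop)]
    refine (lintegral_mono fun ω => ?_).trans (h3 t)
    have := ENNReal.coe_le_coe.2 ((h2 t ω).dualMACPower_add_le B.noise_pos)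
    rwa [ENNReal.coe_add] at this
  obtain ⟨ρ, hρ, hp, hr⟩ := hπ'.exists_average hT
  let S : Fin 2 → ℝ≥0∞ := fun i => ∑ s : Fin T, ((T : ℝ≥0)⁻¹ : ℝ≥0) * B.meanPower π' s i
  have hS : S 0 + S 1 ≤ B.power := by
    have hT' : (T : ℝ≥0) ≠ 0 := by positivity
    calc S 0 + S 1 = ∑ s : Fin T, ((T : ℝ≥0)⁻¹ : ℝ≥0) *
          (B.meanPower π' s 0 + B.meanPower π' s 1) := by
          simp only [S, ← Finset.sum_add_distrib, mul_add]
      _ ≤ ∑ _s : Fin T, ((T : ℝ≥0)⁻¹ : ℝ≥0) * (B.power : ℝ≥0∞) := by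
          gcongr
          exact hpow _
      _ = B.power := by
          rw [← Finset.sum_mul]
          norm_cast
          simp [hT']
  have hfin (i : Fin 2) : S i ≠ ∞ := by
    refine ne_top_of_le_ne_top ENNReal.coe_ne_top (le_trans ?_ hS)
    fin_cases i
    exacts [le_self_add, le_add_self]
  have hS0 : (S 0).toNNReal ≤ B.power :=
    (ENNReal.toNNReal_mono ENNReal.coe_ne_top (le_self_add.trans hS)).trans_eq (by simp)
  have hS1 : S 1 ≤ (B.power - (S 0).toNNReal : ℝ≥0) := by
    rw [ENNReal.coe_sub, ENNReal.coe_toNNReal (hfin 0)]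
    exact ENNReal.le_sub_of_add_le_left (hfin 0) hS
  -- The unused power goes to the second user, so that the split sums exactly to the budget.
  refine ⟨![(S 0).toNNReal, B.power - (S 0).toNNReal], by simpa using add_tsub_cancel_of_le hS0,
    ρ, hρ, fun i t => (hp i t).trans ?_, ?_⟩
  · fin_cases i
    exacts [(ENNReal.coe_toNNReal (hfin 0)).ge, hS1]
  · have e : (fun i => (∑ t ∈ Finset.range T, ∫ ω, (π.rateAt t ω i : ℝ) ∂B.law) / (T : ℝ)) =
        fun i => (∑ t ∈ Finset.range T, (B.meanRate π' t i).toReal) / (T : ℝ) := by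
      simp only [FadingModel.integral_rateAt]
      rfl
    rwa [e]

/-- Rates are kept and powers are dualized in each slot; the two individual constraints add up to
the broadcast constraint, so no averaging is needed. -/
theorem MACNetwork.Admissible.exists_broadcast {N : MACNetwork} {B : BCNetwork}
    (hNB : N.IsDual B) {π : Policy} (h : N.Admissible π) :
    B.Admissible (π.withPower (measurable_dualBCPower B.noise)) := by
  obtain ⟨h1, h2, h3⟩ := h
  obtain ⟨e, hP⟩ := hNB
  rw [e] at h1 h2 h3
  refine ⟨h1, fun t ω => (h2 t ω).bcSupports B.noise_pos, fun t => ?_⟩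
  have hm := π.measurable_powerAt t
  calc _ ≤ ∫⁻ ω, ((π.powerAt t ω 0 : ℝ≥0∞) + π.powerAt t ω 1) ∂B.law :=
        lintegral_mono fun ω => (ENNReal.coe_le_coe.2
          ((h2 t ω).dualBCPower_add_le B.noise_pos)).trans_eq (ENNReal.coe_add _ _)
    _ = ∫⁻ ω, (π.powerAt t ω 0 : ℝ≥0∞) ∂B.law + ∫⁻ ω, (π.powerAt t ω 1 : ℝ≥0∞) ∂B.law :=
        lintegral_add_left (by fun_prop) _
    _ ≤ N.power 0 + N.power 1 := add_le_add (h3 0 t) (h3 1 t)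
    _ = B.power := by exact_mod_cast hP

theorem isCompact_powerSplits (P : ℝ≥0) : IsCompact {q : Fin 2 → ℝ≥0 | q 0 + q 1 = P} := by
  refine (isCompact_univ_pi fun _ : Fin 2 => isCompact_Icc (a := (0 : ℝ≥0)) (b := P))
    |>.of_isClosed_subset
    (isClosed_eq (by fun_prop) (by fun_prop)) ?_
  rintro q rfl i -
  refine ⟨zero_le, ?_⟩
  fin_cases i
  exacts [le_self_add, le_add_self]

theorem BCNetwork.exists_dual_of_mem {B : BCNetwork} {x : Fin 2 → ℝ}
    (hx : x ∈ B.stabilityRegion) : ∃ N : MACNetwork, N.IsDual B ∧ x ∈ N.stabilityRegion := by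
  have happrox : ∀ n : ℕ, ∃ y q, dist y x < 1 / ((n : ℝ) + 1) ∧ q ∈ {q : Fin 2 → ℝ≥0 |
      q 0 + q 1 = B.power} ∧ B.toFadingModel.Achieves q y := by
    intro n
    have hU : IsOpen (Metric.ball x (1 / ((n : ℝ) + 1))) := Metric.isOpen_ball
    obtain ⟨z, hzU, π, hπ, hz⟩ := mem_closure_iff.1 hx _ hU (Metric.mem_ball_self (by positivity))
    -- A finite-horizon average already lies in the ball, and such averages are achieved with a
    -- fixed split.
    obtain ⟨T, hTU, hT⟩ := (((tendsto_pi_nhds.2 hz).eventually (hU.mem_nhds hzU)).and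
      (eventually_gt_atTop 0)).exists
    obtain ⟨q, hq, hy⟩ := hπ.exists_achieves hT
    exact ⟨_, q, hTU, hq, hy⟩
  choose y q hy hq hqy using happrox
  have hylim : Tendsto y atTop (𝓝 x) := tendsto_iff_dist_tendsto_zero.2 <|
    squeeze_zero (fun _ => dist_nonneg) (fun n => (hy n).le) tendsto_one_div_add_atTop_nhds_zero_nat
  obtain ⟨q', hq', φ, hφ, hlim⟩ := (isCompact_powerSplits B.power).tendsto_subseq hq
  refine ⟨⟨B.toFadingModel, q'⟩, ⟨rfl, hq'⟩, ?_⟩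
  rw [MACNetwork.stabilityRegion_eq]
  exact FadingModel.mem_closure_achieves (fun n => hqy (φ n)) (fun n => hq (φ n)) hlim
    (hylim.comp hφ.tendsto_atTop)

end Fading

end

theorem theorem3 (B : Fading.BCNetwork) :
    B.stabilityRegion =
      ⋃ (M : Fading.MACNetwork) (_ : M.IsDual B), M.stabilityRegion := by
  apply Set.Subset.antisymm
  · intro x hx
    simpa using B.exists_dual_of_mem hx
  · refine Set.iUnion₂_subset fun M hM => closure_mono ?_
    rintro x ⟨π, hπ, hx⟩
    refine ⟨_, hπ.exists_broadcast hM, ?_⟩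
    rw [hM.1] at hx
    exact hx
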